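/- Let $A$ be a commutative unitary ring which is von Neumann regular and real (if $\sum_i a_i^2=0$ then all $a_i=0$), equipped with a partial ordering compatible with the ring structure, with positive cone $A^+\ni 1$. Let $Q(A)$ be the complete ring of quotients of $A$, let $B(A)$ be the Baer hull of $A$, i.e. the smallest Baer subring of $Q(A)$ containing $A$ (a commutative ring is Baer if the annihilator of each of its subsets is generated by an idempotent), and let $$B(A)^+=\Big\{\sum_{i=1}^n b_i^2a_i \;:\; n\in\mathbb N,\ b_i\in B(A),\ a_i\in A^+\Big\}.$$ For $R\in\{A,B(A)\}$ let $\operatorname{Sper}R$ be the set of prime cones $\alpha$ of $R$ with $R^+\subseteq\alpha$, with the Harrison topology, generated by the sets $P(x)=\{\alpha : x\in\alpha\setminus\operatorname{supp}(\alpha)\}$, $x\in R$, and let $\operatorname{supp}_R:\operatorname{Sper}R\to\operatorname{Spec}R$, $\alpha\mapsto\alpha\cap-\alpha$, be the support map. Let $\phi_p:\operatorname{Spec}B(A)\to\operatorname{Spec}A$, $\mathfrak p\mapsto\mathfrak p\cap A$, be the canonical map, and let $$X=\operatorname{Sper}A\times_{\operatorname{Spec}A}\operatorname{Spec}B(A)=\{(\alpha,\mathfrak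 p) : \operatorname{supp}_A(\alpha)=\phi_p(\mathfrak p)\}$$ be the fibre product over $\operatorname{supp}_A$ and $\phi_p$, with the subspace topology of the product. Then the canonical map $$\operatorname{Sper}B(A)\longrightarrow X,\qquad \beta\longmapsto(\beta\cap A,\ \operatorname{supp}_{B(A)}(\beta)),$$ is a homeomorphism. -/

import Mathlib

/-- A commutative ring is von Neumann regular if every element has a quasi-inverse. -/
def IsVonNeumannRegular (R : Type*) [CommRing R] : Prop :=
  ∀ a : R, ∃ b : R, a * b * a = a

/-- A commutative ring is Baer if the annihilator of every subset is generated by an idempotent. -/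
def IsBaerRing (R : Type*) [CommRing R] : Prop :=
  ∀ S : Set R, ∃ e : R, IsIdempotentElem e ∧
    ∀ x : R, (∀ s ∈ S, x * s = 0) ↔ x ∈ Ideal.span {e}

/-! ### The complete ring of quotients -/

/-- An ideal `D` is dense if `x D = 0` implies `x = 0`. -/
def Ideal.IsDense {A : Type*} [CommRing A] (D : Ideal A) : Prop :=
  ∀ x : A, (∀ d ∈ D, x * d = 0) → x = 0

/-- The disjoint union of the modules `Hom_A(D, A)`, where `D` runs through the dense ideals. -/
structure DenseHom (A : Type*) [CommRing A] where
  dom : Ideal A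
  dense : dom.IsDense
  hom : dom →ₗ[A] A

namespace DenseHom

variable {A : Type*} [CommRing A]

theorem hom_mul (f : DenseHom A) (a x : A) (hx : x ∈ f.dom) (h : a * x ∈ f.dom) :
    f.hom ⟨a * x, h⟩ = a * f.hom ⟨x, hx⟩ :=
  f.hom.map_smul a ⟨x, hx⟩

theorem hom_congr (f : DenseHom A) {x y : A} (h : x = y) (hx : x ∈ f.dom) :
    f.hom ⟨x, hx⟩ = f.hom ⟨y, h ▸ hx⟩ := by
  subst h; rfl

theorem hom_add (f : DenseHom A) (x y : A) (hx : x ∈ f.dom) (hy : y ∈ f.dom)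
    (h : x + y ∈ f.dom) :
    f.hom ⟨x + y, h⟩ = f.hom ⟨x, hx⟩ + f.hom ⟨y, hy⟩ :=
  f.hom.map_add ⟨x, hx⟩ ⟨y, hy⟩

/-- `D` and `D'` dense imply that everything containing the products `d * d'` is dense. -/
theorem dense_of_mul {D D' E : Ideal A} (hD : D.IsDense) (hD' : D'.IsDense)
    (h : ∀ d ∈ D, ∀ d' ∈ D', d * d' ∈ E) : E.IsDense := fun x hx =>
  hD x fun d hd => hD' _ fun d' hd' => by rw [mul_assoc]; exact hx _ (h d hd d' hd')

/-- Two homomorphisms are identified if they agree on the intersection of their domains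
(equivalently, on some dense ideal). -/
def Rel (f g : DenseHom A) : Prop :=
  ∀ (x : A) (hf : x ∈ f.dom) (hg : x ∈ g.dom), f.hom ⟨x, hf⟩ = g.hom ⟨x, hg⟩

/-- Agreement of `f` and `g` may be tested on a dense ideal of multipliers. -/
theorem rel_of_dense {f g : DenseHom A} {D : Ideal A} (hD : D.IsDense)
    (h : ∀ d ∈ D, ∀ (x : A) (hf : x ∈ f.dom) (hg : x ∈ g.dom),
      d * f.hom ⟨x, hf⟩ = d * g.hom ⟨x, hg⟩) : f.Rel g := fun x hf hg =>
  sub_eq_zero.1 <| hD _ fun d hd => by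
    rw [sub_mul, mul_comm _ d, mul_comm _ d, h d hd x hf hg, sub_self]

instance setoid (A : Type*) [CommRing A] : Setoid (DenseHom A) where
  r := Rel
  iseqv :=
    { refl := fun _ _ _ _ => rfl
      symm := fun h x hf hg => (h x hg hf).symm
      trans := fun {f g k} h h' => rel_of_dense g.dense fun d hd x hf hk => by
        have hg : d * x ∈ g.dom := g.dom.mul_mem_right x hd
        rw [← f.hom_mul d x hf (f.dom.mul_mem_left d hf),
          ← k.hom_mul d x hk (k.dom.mul_mem_left d hk), h _ _ hg, h' _ hg _] }

/-- Multiplication by `a`, defined on all of `A`. -/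
def const (a : A) : DenseHom A where
  dom := ⊤
  dense := fun x hx => by simpa using hx 1 trivial
  hom :=
    { toFun := fun x => a * x
      map_add' := fun x y => mul_add a x y
      map_smul' := fun c x => by simp [mul_left_comm] }

/-- The sum, on the intersection of the domains. -/
def add (f g : DenseHom A) : DenseHom A where
  dom := f.dom ⊓ g.dom
  dense := dense_of_mul f.dense g.dense fun d hd d' hd' =>
    ⟨f.dom.mul_mem_right d' hd, g.dom.mul_mem_left d hd'⟩
  hom :=
    { toFun := fun x => f.hom ⟨x, x.2.1⟩ + g.hom ⟨x, x.2.2⟩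
      map_add' := fun x y => by
        have h1 := f.hom_add x y x.2.1 y.2.1 (f.dom.add_mem x.2.1 y.2.1)
        have h2 := g.hom_add x y x.2.2 y.2.2 (g.dom.add_mem x.2.2 y.2.2)
        simp only [Submodule.coe_add, h1, h2]; ring
      map_smul' := fun c x => by
        have h1 := f.hom_mul c x x.2.1 (f.dom.mul_mem_left c x.2.1)
        have h2 := g.hom_mul c x x.2.2 (g.dom.mul_mem_left c x.2.2)
        simp only [Submodule.coe_smul, smul_eq_mul, RingHom.id_apply, h1, h2]; ring }

/-- The negative. -/
def neg (f : DenseHom A) : DenseHom A where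
  dom := f.dom
  dense := f.dense
  hom := -f.hom

/-- The composition `x ↦ f (g x)`, on the largest ideal where it is defined. -/
def mul (f g : DenseHom A) : DenseHom A where
  dom :=
    { carrier := {x | ∃ h : x ∈ g.dom, g.hom ⟨x, h⟩ ∈ f.dom}
      add_mem' := by
        rintro x y ⟨hx, hx'⟩ ⟨hy, hy'⟩
        exact ⟨g.dom.add_mem hx hy, by
          rw [g.hom_add x y hx hy]; exact f.dom.add_mem hx' hy'⟩
      zero_mem' := ⟨g.dom.zero_mem, by
        have : g.hom ⟨0, g.dom.zero_mem⟩ = 0 := g.hom.map_zero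
        rw [this]; exact f.dom.zero_mem⟩
      smul_mem' := by
        rintro c x ⟨hx, hx'⟩
        exact ⟨g.dom.mul_mem_left c hx, by
          rw [show g.hom ⟨c • x, g.dom.mul_mem_left c hx⟩ = c * g.hom ⟨x, hx⟩ from
            g.hom_mul c x hx _]
          exact f.dom.mul_mem_left c hx'⟩ }
  dense := dense_of_mul f.dense g.dense fun d hd d' hd' =>
    ⟨g.dom.mul_mem_left d hd', by
      rw [g.hom_mul d d' hd']; exact f.dom.mul_mem_right _ hd⟩
  hom :=
    { toFun := fun x => f.hom ⟨g.hom ⟨x, x.2.1⟩, x.2.2⟩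
      map_add' := fun x y => by
        rw [← f.hom_add _ _ x.2.2 y.2.2 (f.dom.add_mem x.2.2 y.2.2)]
        exact f.hom_congr (g.hom_add x y x.2.1 y.2.1 _) _
      map_smul' := fun c x => by
        rw [RingHom.id_apply, smul_eq_mul,
          ← f.hom_mul c _ x.2.2 (f.dom.mul_mem_left c x.2.2)]
        exact f.hom_congr (g.hom_mul c x x.2.1 _) _ }

theorem add_rel {f f' g g' : DenseHom A} (h : f ≈ f') (h' : g ≈ g') : f.add g ≈ f'.add g' :=
  fun x hx hx' => congrArg₂ (· + ·) (h x hx.1 hx'.1) (h' x hx.2 hx'.2)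

theorem neg_rel {f f' : DenseHom A} (h : f ≈ f') : f.neg ≈ f'.neg :=
  fun x hx hx' => congrArg (- ·) (h x hx hx')

theorem mul_rel {f f' g g' : DenseHom A} (h : f ≈ f') (h' : g ≈ g') : f.mul g ≈ f'.mul g' := by
  rintro x ⟨hx, hx1⟩ ⟨hx', hx1'⟩
  have e := h' x hx hx'
  exact (f.hom_congr e hx1).trans (h _ _ hx1')

theorem mul_comm_rel (f g : DenseHom A) : f.mul g ≈ g.mul f := by
  refine rel_of_dense (dense_of_mul f.dense g.dense (E := f.dom ⊓ g.dom) fun d hd d' hd' =>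
    ⟨f.dom.mul_mem_right d' hd, g.dom.mul_mem_left d hd'⟩) ?_
  rintro d ⟨hdf, hdg⟩ x ⟨hx, hx1⟩ ⟨hy, hy1⟩
  change d * f.hom ⟨g.hom ⟨x, hx⟩, hx1⟩ = d * g.hom ⟨f.hom ⟨x, hy⟩, hy1⟩
  have hxg : g.hom ⟨x, hx⟩ * d ∈ f.dom := f.dom.mul_mem_left _ hdf
  have hxf : f.hom ⟨x, hy⟩ * d ∈ g.dom := g.dom.mul_mem_left _ hdg
  have e1 : g.hom ⟨x, hx⟩ * d = g.hom ⟨d, hdg⟩ * x := by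
    rw [mul_comm _ d, mul_comm _ x, ← g.hom_mul d x hx (g.dom.mul_mem_left d hx),
      ← g.hom_mul x d hdg (g.dom.mul_mem_left x hdg)]
    exact g.hom_congr (mul_comm d x) _
  calc d * f.hom ⟨g.hom ⟨x, hx⟩, hx1⟩
      = f.hom ⟨d * g.hom ⟨x, hx⟩, f.dom.mul_mem_left d hx1⟩ := (f.hom_mul d _ hx1 _).symm
    _ = f.hom ⟨g.hom ⟨d, hdg⟩ * x, f.dom.mul_mem_left _ hy⟩ :=
        f.hom_congr ((mul_comm _ _).trans e1) _
    _ = g.hom ⟨d, hdg⟩ * f.hom ⟨x, hy⟩ := f.hom_mul _ x hy _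
    _ = f.hom ⟨x, hy⟩ * g.hom ⟨d, hdg⟩ := mul_comm _ _
    _ = g.hom ⟨f.hom ⟨x, hy⟩ * d, hxf⟩ := (g.hom_mul _ d hdg _).symm
    _ = g.hom ⟨d * f.hom ⟨x, hy⟩, g.dom.mul_mem_left d hy1⟩ := g.hom_congr (mul_comm _ _) _
    _ = d * g.hom ⟨f.hom ⟨x, hy⟩, hy1⟩ := g.hom_mul d _ hy1 _

end DenseHom

/-- The complete ring of quotients `Q(A)` of a commutative ring `A`. -/
def CompleteQuotientRing (A : Type*) [CommRing A] : Type _ :=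
  Quotient (DenseHom.setoid A)

namespace CompleteQuotientRing

variable {A : Type*} [CommRing A]

theorem left_distrib_aux (f g k : DenseHom A) :
    f.mul (g.add k) ≈ (f.mul g).add (f.mul k) := by
  rintro x ⟨hx, hx1⟩ ⟨⟨h1, h2⟩, h3, h4⟩
  exact f.hom_add _ _ h2 h4 hx1

instance : Zero (CompleteQuotientRing A) := ⟨Quotient.mk _ (DenseHom.const 0)⟩

instance : One (CompleteQuotientRing A) := ⟨Quotient.mk _ (DenseHom.const 1)⟩

instance : Add (CompleteQuotientRing A) :=
  ⟨Quotient.map₂ DenseHom.add fun _ _ h _ _ h' => DenseHom.add_rel h h'⟩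

instance : Mul (CompleteQuotientRing A) :=
  ⟨Quotient.map₂ DenseHom.mul fun _ _ h _ _ h' => DenseHom.mul_rel h h'⟩

instance : Neg (CompleteQuotientRing A) :=
  ⟨Quotient.map DenseHom.neg fun _ _ h => DenseHom.neg_rel h⟩

instance : CommRing (CompleteQuotientRing A) where
  nsmul := nsmulRec
  zsmul := zsmulRec
  add_assoc := by
    rintro ⟨f⟩ ⟨g⟩ ⟨k⟩
    exact Quotient.sound fun x _ _ => add_assoc _ _ _
  add_comm := by
    rintro ⟨f⟩ ⟨g⟩
    exact Quotient.sound fun x _ _ => add_comm _ _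
  zero_add := by
    rintro ⟨f⟩
    exact Quotient.sound fun x _ h =>
      show 0 * x + f.hom ⟨x, h⟩ = f.hom ⟨x, h⟩ by rw [zero_mul, zero_add]
  add_zero := by
    rintro ⟨f⟩
    exact Quotient.sound fun x _ h =>
      show f.hom ⟨x, h⟩ + 0 * x = f.hom ⟨x, h⟩ by rw [zero_mul, add_zero]
  neg_add_cancel := by
    rintro ⟨f⟩
    exact Quotient.sound fun x h _ =>
      show -f.hom ⟨x, h.1⟩ + f.hom ⟨x, h.1⟩ = 0 * x by rw [zero_mul, neg_add_cancel]
  mul_assoc := by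
    rintro ⟨f⟩ ⟨g⟩ ⟨k⟩
    exact Quotient.sound fun x _ _ => rfl
  mul_comm := by
    rintro ⟨f⟩ ⟨g⟩
    exact Quotient.sound (DenseHom.mul_comm_rel f g)
  one_mul := by
    rintro ⟨f⟩
    exact Quotient.sound fun x h _ => one_mul (f.hom ⟨x, h.1⟩)
  mul_one := by
    rintro ⟨f⟩
    exact Quotient.sound fun x h h' => f.hom_congr (one_mul x) h.2
  zero_mul := by
    rintro ⟨f⟩
    exact Quotient.sound fun x h _ =>
      show 0 * f.hom ⟨x, h.1⟩ = 0 * x by rw [zero_mul, zero_mul]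
  mul_zero := by
    rintro ⟨f⟩
    refine Quotient.sound (Setoid.trans (DenseHom.mul_comm_rel _ _) ?_)
    exact fun x h _ => show 0 * f.hom ⟨x, h.1⟩ = 0 * x by rw [zero_mul, zero_mul]
  left_distrib := by
    rintro ⟨f⟩ ⟨g⟩ ⟨k⟩
    exact Quotient.sound (left_distrib_aux f g k)
  right_distrib := by
    rintro ⟨f⟩ ⟨g⟩ ⟨k⟩
    exact Quotient.sound fun x _ _ => rfl

/-- The canonical homomorphism `A → Q(A)`, sending `a` to multiplication by `a`. -/
def ofRing (A : Type*) [CommRing A] : A →+* CompleteQuotientRing A where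
  toFun a := Quotient.mk _ (DenseHom.const a)
  map_zero' := rfl
  map_one' := rfl
  map_add' a b := Quotient.sound fun x _ _ => add_mul a b x
  map_mul' a b := Quotient.sound fun x _ _ => mul_assoc a b x

instance : Algebra A (CompleteQuotientRing A) := (ofRing A).toAlgebra

end CompleteQuotientRing

/-- The Baer hull `B(A)`: the smallest Baer ring between `A` and `Q(A)`, i.e. the intersection of
all Baer subrings of `Q(A)` that contain `A`. -/
def baerHull (A : Type*) [CommRing A] : Subalgebra A (CompleteQuotientRing A) :=
  sInf {C : Subalgebra A (CompleteQuotientRing A) | IsBaerRing C}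

/-! ### Real spectra of partially ordered rings -/

/-- The positive cone `A⁺`. -/
def positiveCone (A : Type*) [CommRing A] [PartialOrder A] : Set A := {a | 0 ≤ a}

/-- The weakest extension of a cone `T` of `A` to an `A`-algebra `B`:
the set of all finite sums `∑ bᵢ² aᵢ` with `bᵢ ∈ B` and `aᵢ ∈ T`. -/
def extendedCone {A : Type*} (B : Type*) [CommRing A] [CommRing B] [Algebra A B] (T : Set A) :
    Set B :=
  {y | ∃ (n : ℕ) (b : Fin n → B) (a : Fin n → A),
    (∀ i, a i ∈ T) ∧ y = ∑ i, b i ^ 2 * algebraMap A B (a i)}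

/-- The real spectrum of the ring `R` with positive cone `T`: the set of all prime cones of `R`
that contain `T`. (A `RingPreordering` is a prime cone when it satisfies `IsOrdering`.) -/
@[ext]
structure Sper {R : Type*} [CommRing R] (T : Set R) where
  cone : RingPreordering R
  isOrdering : cone.IsOrdering
  subset : T ⊆ (cone : Set R)

namespace Sper

variable {R S : Type*} [CommRing R] [CommRing S]

/-- The support map into the prime spectrum, `α ↦ α ∩ -α`. -/
def supp {T : Set R} (α : Sper T) : PrimeSpectrum R :=
  haveI := α.isOrdering
  ⟨α.cone.support, α.isOrdering.toIsPrime⟩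

/-- The basic open set `P(x) = {α | x ∈ α \ supp α}`. -/
def basicOpen (T : Set R) (x : R) : Set (Sper T) :=
  {α | x ∈ α.cone ∧ x ∉ α.supp.asIdeal}

/-- The Harrison topology, generated by the sets `P(x)`. -/
instance (T : Set R) : TopologicalSpace (Sper T) :=
  TopologicalSpace.generateFrom (Set.range (basicOpen T))

/-- The map of real spectra `β ↦ f⁻¹(β)` induced by a ring homomorphism `f` with `f(T) ⊆ U`. -/
def comap {T : Set R} {U : Set S} (f : R →+* S) (hf : ∀ t ∈ T, f t ∈ U) (β : Sper U) :
    Sper T where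
  cone :=
    { toSubsemiring := β.cone.toSubsemiring.comap f
      mem_of_isSquare' := fun hx => β.cone.mem_of_isSquare (hx.map f)
      neg_one_notMem' := fun h => β.cone.neg_one_notMem (by
        have h' : f (-1) ∈ β.cone := h
        rwa [map_neg, map_one] at h') }
  isOrdering := by
    have := β.isOrdering
    refine RingPreordering.isOrdering_iff.2 fun a b h => ?_
    refine RingPreordering.isOrdering_iff.1 this (f a) (f b) ?_
    have h' : f (-(a * b)) ∈ β.cone := h
    rwa [map_neg, map_mul] at h'
  subset := fun t ht => β.subset (hf t ht)

end Sper

/-- The cone `B⁺` contains the image of `A⁺`. -/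
theorem algebraMap_mem_extendedCone {A : Type*} (B : Type*) [CommRing A] [CommRing B]
    [Algebra A B] (T : Set A) : ∀ t ∈ T, algebraMap A B t ∈ extendedCone B T := fun t ht =>
  ⟨1, fun _ => 1, fun _ => t, fun _ => ht, by simp⟩

/-! The point is that $B(A)$ is generated over $A$ by all idempotents of $Q(A)$
(`baerHull_eq_adjoin_idempotents`); regularity enters through reducedness. An idempotent is $0$ or
$1$ near each prime, so every $b \in B(A)$ agrees on a Zariski neighbourhood of each prime
$\mathfrak p$ with some $a \in A$ (`isLocallyConstantAlgebra_baerHull`).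

Pointwise, this says that $A \to B(A)/\mathfrak p$ is onto, so $A/(\mathfrak p \cap A) \cong
B(A)/\mathfrak p$. Prime cones with support $\mathfrak p$ therefore correspond to prime cones of $A$
with support $\mathfrak p \cap A$, which gives the bijection. Since the agreement holds on a whole
neighbourhood, the inverse is continuous (`continuous_ofPullback`). -/

theorem IsVonNeumannRegular.isReduced {A : Type*} [CommRing A] (hA : IsVonNeumannRegular A) :
    IsReduced A := by
  refine (isReduced_iff_pow_one_lt 2 one_lt_two).2 fun x hx => ?_
  obtain ⟨b, hb⟩ := hA x
  rw [← hb, mul_right_comm, ← pow_two, hx, zero_mul]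

theorem eq_zero_of_mul_self {A : Type*} [CommRing A] [IsReduced A] {x : A}
    (h : x * x = 0) : x = 0 :=
  (IsNilpotent.mk x 2 (by rw [pow_two, h])).eq_zero

/-! ### Idempotents of the complete ring of quotients -/

namespace CompleteQuotientRing

variable {A : Type*} [CommRing A]

/-- If $f : D \to A$ represents $q$, then $qd = f(d)$ for $d \in D$. With `eq_zero_of_dense` this
reduces identities in $Q(A)$ to identities in $A$. -/
theorem exists_dense_mul_algebraMap (q : CompleteQuotientRing A) :
    ∃ D : Ideal A, D.IsDense ∧ ∀ d ∈ D, ∃ a : A,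
      q * algebraMap A (CompleteQuotientRing A) d = algebraMap A _ a := by
  obtain ⟨f⟩ := q
  refine ⟨f.dom, f.dense, fun d hd => ⟨f.hom ⟨d, hd⟩, Quotient.sound ?_⟩⟩
  intro x hx _
  calc f.hom ⟨d * x, hx.2⟩ = f.hom ⟨x * d, f.dom.mul_mem_left x hd⟩ :=
        f.hom_congr (mul_comm d x) _
    _ = x * f.hom ⟨d, hd⟩ := f.hom_mul x d hd _
    _ = f.hom ⟨d, hd⟩ * x := mul_comm _ _

theorem eq_zero_of_dense {D : Ideal A} (hD : D.IsDense) {q : CompleteQuotientRing A}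
    (h : ∀ d ∈ D, q * algebraMap A (CompleteQuotientRing A) d = 0) : q = 0 := by
  obtain ⟨f⟩ := q
  refine Quotient.sound fun x hx _ => ?_
  change f.hom ⟨x, hx⟩ = 0 * x
  rw [zero_mul]
  refine hD _ fun d hd => ?_
  have hdx : d * x ∈ f.dom := f.dom.mul_mem_left d hx
  have h0 : f.hom ⟨d * x, hdx⟩ = 0 * x := Quotient.exact (h d hd) x ⟨trivial, hdx⟩ trivial
  rw [mul_comm, ← f.hom_mul d x hx hdx, h0, zero_mul]

/-- A Baer ring between `A` and `Q(A)` contains all idempotents of `Q(A)`. -/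
theorem mem_of_isIdempotentElem {C : Subalgebra A (CompleteQuotientRing A)} (hC : IsBaerRing C)
    {e : CompleteQuotientRing A} (he : IsIdempotentElem e) : e ∈ C := by
  -- As $e$ is not yet known to lie in $C$, it is recovered as the generator $f$ of the double
  -- annihilator: $f$ annihilates $\{x \in C : xe = 0\}$.
  obtain ⟨f, hf, hann⟩ := hC {x : C | (x : CompleteQuotientRing A) * e = 0}
  obtain ⟨D, hD, hDe⟩ := exists_dense_mul_algebraMap e
  have hff : (f : CompleteQuotientRing A) * f = f := congrArg Subtype.val hf.eq
  -- For $d \in D$, the element $(1-e)d$ lies in $A$ and kills $e$, so $f$ kills it.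
  have h1 : (f : CompleteQuotientRing A) * (1 - e) = 0 := by
    refine eq_zero_of_dense hD fun d hd => ?_
    obtain ⟨a, ha⟩ := hDe d hd
    have hs : ((algebraMap A C (d - a) : C) : CompleteQuotientRing A) =
        (1 - e) * algebraMap A _ d := by
      rw [Subalgebra.coe_algebraMap, map_sub, ← ha]; ring
    have := (hann f).2 (Ideal.mem_span_singleton_self f) (algebraMap A C (d - a)) (by
      change _ * e = 0
      rw [hs]; linear_combination (-algebraMap A (CompleteQuotientRing A) d) * he.eq)
    have := congrArg Subtype.val this
    rw [Subalgebra.coe_mul, hs] at this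
    rw [mul_assoc]; exact this
  -- For $d \in D$, the element $ed$ lies in $A$ and kills the chosen set, so it is a multiple of
  -- $f$.
  have h2 : (1 - (f : CompleteQuotientRing A)) * e = 0 := by
    refine eq_zero_of_dense hD fun d hd => ?_
    obtain ⟨a, ha⟩ := hDe d hd
    have hmem : algebraMap A C a ∈ Ideal.span {f} := by
      refine (hann _).1 fun s hs => Subtype.ext ?_
      have hs' : (s : CompleteQuotientRing A) * e = 0 := hs
      rw [Subalgebra.coe_mul, Subalgebra.coe_algebraMap, ← ha]
      change _ = 0
      linear_combination algebraMap A (CompleteQuotientRing A) d * hs'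
    obtain ⟨c, hc⟩ := Ideal.mem_span_singleton'.1 hmem
    have hc' := congrArg Subtype.val hc
    rw [Subalgebra.coe_mul, Subalgebra.coe_algebraMap, ← ha] at hc'
    rw [mul_assoc, ← hc']
    linear_combination (-(c : CompleteQuotientRing A)) * hff
  have : e = f := by linear_combination h2 - h1
  exact this ▸ f.2

/-- In a reduced ring, an ideal and its annihilator intersect trivially and have a dense sum; the
projection of the sum to the ideal is an idempotent of `Q(A)`. -/
theorem exists_idempotent_of_ideal [IsReduced A] (I : Ideal A) :
    ∃ e : CompleteQuotientRing A, IsIdempotentElem e ∧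
      (∀ a ∈ I, e * algebraMap A _ a = algebraMap A _ a) ∧
      ∀ q : CompleteQuotientRing A, (∀ a ∈ I, algebraMap A _ a * q = 0) → e * q = 0 := by
  have hmeet : ∀ x ∈ I, (∀ i ∈ I, x * i = 0) → x = 0 := fun x hx h =>
    eq_zero_of_mul_self (h x hx)
  let J : Ideal A :=
    { carrier := {x | ∀ i ∈ I, x * i = 0}
      add_mem' := fun hx hy i hi => by rw [add_mul, hx i hi, hy i hi, add_zero]
      zero_mem' := fun i _ => zero_mul i
      smul_mem' := fun c x hx i hi => by rw [smul_eq_mul, mul_assoc, hx i hi, mul_zero] }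
  have hdis : ∀ {i i' j j' : A}, i ∈ I → i' ∈ I → j ∈ J → j' ∈ J → i + j = i' + j' → i = i' := by
    intro i i' j j' hi hi' hj hj' h
    refine sub_eq_zero.1 (hmeet _ (I.sub_mem hi hi') ?_)
    have : i - i' = j' - j := by linear_combination h
    rw [this]
    exact J.sub_mem hj' hj
  -- If $x$ kills $I$ then $x \in J$; if it also kills $J$ then $x^2 = 0$.
  have hdense : (I ⊔ J).IsDense := fun x hx =>
    eq_zero_of_mul_self (hx x (Ideal.mem_sup_right fun i hi => hx i (Ideal.mem_sup_left hi)))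
  have hdec : ∀ x : ↥(I ⊔ J), ∃ i ∈ I, ∃ j ∈ J, i + j = x := fun x => Submodule.mem_sup.1 x.2
  choose p hpI r hrJ hpr using hdec
  let f : DenseHom A :=
    { dom := I ⊔ J
      dense := hdense
      hom :=
        { toFun := p
          map_add' := fun x y => hdis (hpI _) (I.add_mem (hpI _) (hpI _)) (hrJ _)
            (J.add_mem (hrJ x) (hrJ y)) (by
              rw [hpr, Submodule.coe_add, ← hpr x, ← hpr y]; ring)
          map_smul' := fun c x => hdis (hpI _) (I.mul_mem_left c (hpI x)) (hrJ _)
            (J.mul_mem_left c (hrJ x)) (by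
              rw [hpr, Submodule.coe_smul, smul_eq_mul, ← hpr x]; simp; ring) } }
  have hp : ∀ a (ha : a ∈ I) (h : a ∈ I ⊔ J), p ⟨a, h⟩ = a := fun a ha h =>
    hdis (hpI _) ha (hrJ _) J.zero_mem (by rw [hpr, add_zero])
  let e : CompleteQuotientRing A := Quotient.mk _ f
  have he : ∀ x : ↥(I ⊔ J), e * algebraMap A (CompleteQuotientRing A) x = algebraMap A _ (p x) :=
    fun x => Quotient.sound fun y hy _ => by
      have hxy : (x : A) * y ∈ I ⊔ J := hy.2
      change p ⟨x * y, hxy⟩ = p x * y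
      refine hdis (hpI _) (I.mul_mem_right y (hpI x)) (hrJ ⟨x * y, hxy⟩)
        (J.mul_mem_right y (hrJ x)) ?_
      rw [hpr, ← add_mul, hpr]
  refine ⟨e, ?_, fun a ha => ?_, fun q hq => ?_⟩
  · refine sub_eq_zero.1 (eq_zero_of_dense hdense fun d hd => ?_)
    rw [sub_mul, mul_assoc, he ⟨d, hd⟩]
    rw [he ⟨p ⟨d, hd⟩, Ideal.mem_sup_left (hpI _)⟩, hp _ (hpI _), sub_self]
  · rw [he ⟨a, Ideal.mem_sup_left ha⟩, hp a ha]
  · refine eq_zero_of_dense hdense fun d hd => ?_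
    rw [mul_right_comm, he ⟨d, hd⟩, hq _ (hpI _)]

/-- The annihilator of a subset of `Q(A)` is generated by an idempotent. -/
theorem exists_idempotent_annihilator [IsReduced A] (S : Set (CompleteQuotientRing A)) :
    ∃ e : CompleteQuotientRing A, IsIdempotentElem e ∧
      ∀ x, (∀ s ∈ S, x * s = 0) ↔ x = e * x := by
  -- The annihilator of $S$ is determined by its trace $I$ on $A$: if $x$ kills $S$, its multiples
  -- lying in $A$ lie in $I$, hence are fixed by $e$.
  let I : Ideal A :=
    { carrier := {a | ∀ s ∈ S, algebraMap A (CompleteQuotientRing A) a * s = 0}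
      add_mem' := fun hx hy s hs => by rw [map_add, add_mul, hx s hs, hy s hs, add_zero]
      zero_mem' := fun s _ => by rw [map_zero, zero_mul]
      smul_mem' := fun c x hx s hs => by
        rw [smul_eq_mul, map_mul, mul_assoc, hx s hs, mul_zero] }
  obtain ⟨e, he, heI, hann⟩ := exists_idempotent_of_ideal I
  refine ⟨e, he, fun x => ⟨fun hx => ?_, fun hx s hs => ?_⟩⟩
  · obtain ⟨D, hD, hDx⟩ := exists_dense_mul_algebraMap x
    refine sub_eq_zero.1 (eq_zero_of_dense hD fun d hd => ?_)
    obtain ⟨a, ha⟩ := hDx d hd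
    have haI : a ∈ I := fun s hs => by rw [← ha, mul_right_comm, hx s hs, zero_mul]
    rw [sub_mul, mul_assoc, ha, heI a haI, sub_self]
  · rw [hx, mul_right_comm, hann s fun a ha => ha s hs, zero_mul]

/-- The subalgebra of `Q(A)` generated by all idempotents is Baer. -/
theorem isBaerRing_adjoin_idempotents [IsReduced A] :
    IsBaerRing (Algebra.adjoin A {e : CompleteQuotientRing A | IsIdempotentElem e}) := by
  intro S
  obtain ⟨e, he, hann⟩ := exists_idempotent_annihilator (Set.image Subtype.val S)
  refine ⟨⟨e, Algebra.subset_adjoin he⟩, Subtype.ext he, fun x => ?_⟩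
  rw [Ideal.mem_span_singleton']
  constructor
  · intro hx
    refine ⟨x, Subtype.ext ?_⟩
    have := (hann x).1 (by
      rintro _ ⟨s, hs, rfl⟩
      exact congrArg Subtype.val (hx s hs))
    rw [Subalgebra.coe_mul, mul_comm]
    exact this.symm
  · rintro ⟨c, rfl⟩ s hs
    refine Subtype.ext ((hann _).2 ?_ s ⟨s, hs, rfl⟩)
    change (c : CompleteQuotientRing A) * e = e * (c * e)
    rw [mul_left_comm, he.eq]

end CompleteQuotientRing

theorem mem_baerHull_of_isIdempotentElem {A : Type*} [CommRing A] {e : CompleteQuotientRing A}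
    (he : IsIdempotentElem e) : e ∈ baerHull A :=
  Algebra.mem_sInf.2 fun _ hC => CompleteQuotientRing.mem_of_isIdempotentElem hC he

theorem baerHull_eq_adjoin_idempotents (A : Type*) [CommRing A] [IsReduced A] :
    baerHull A = Algebra.adjoin A {e : CompleteQuotientRing A | IsIdempotentElem e} :=
  le_antisymm (sInf_le CompleteQuotientRing.isBaerRing_adjoin_idempotents)
    (Algebra.adjoin_le fun _ he => mem_baerHull_of_isIdempotentElem he)

/-! ### Algebras whose elements are locally constant -/

/-- Every element of `B` agrees, Zariski locally on `Spec B`, with an element of `A`. -/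
def IsLocallyConstantAlgebra (A B : Type*) [CommRing A] [CommRing B] [Algebra A B] : Prop :=
  ∀ (p : PrimeSpectrum B) (b : B), ∃ (e : B) (a : A),
    e ∉ p.asIdeal ∧ e * (b - algebraMap A B a) = 0

theorem isLocallyConstantAlgebra_baerHull (A : Type*) [CommRing A] [IsReduced A] :
    IsLocallyConstantAlgebra A (baerHull A) := by
  rintro p ⟨b, hb⟩
  have hb' := hb
  rw [baerHull_eq_adjoin_idempotents] at hb'
  induction hb' using Algebra.adjoin_induction with
  | mem f hf =>
    have hf' : (⟨f, hb⟩ : baerHull A) * ⟨f, hb⟩ = ⟨f, hb⟩ := Subtype.ext hf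
    -- An idempotent $f$ equals $0$ where $1 - f$ is invertible and $1$ where $f$ is.
    by_cases h : (⟨f, hb⟩ : baerHull A) ∈ p.asIdeal
    · refine ⟨1 - ⟨f, hb⟩, 0, fun h' => ?_, ?_⟩
      · exact p.isPrime.one_notMem (by simpa using p.asIdeal.add_mem h' h)
      · rw [map_zero]; linear_combination -hf'
    · refine ⟨⟨f, hb⟩, 1, h, ?_⟩
      rw [map_one]; linear_combination hf'
  | algebraMap a =>
    exact ⟨1, a, p.isPrime.one_notMem, by
      rw [one_mul]; exact sub_eq_zero.2 rfl⟩
  | add x y hx hy ihx ihy =>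
    rw [← baerHull_eq_adjoin_idempotents] at hx hy
    obtain ⟨e, a, he, h⟩ := ihx hx
    obtain ⟨e', a', he', h'⟩ := ihy hy
    refine ⟨e * e', a + a', p.isPrime.mul_notMem he he', ?_⟩
    rw [map_add, show (⟨x + y, hb⟩ : baerHull A) = ⟨x, hx⟩ + ⟨y, hy⟩ from rfl]
    linear_combination e' * h + e * h'
  | mul x y hx hy ihx ihy =>
    rw [← baerHull_eq_adjoin_idempotents] at hx hy
    obtain ⟨e, a, he, h⟩ := ihx hx
    obtain ⟨e', a', he', h'⟩ := ihy hy
    refine ⟨e * e', a * a', p.isPrime.mul_notMem he he', ?_⟩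
    rw [map_mul, show (⟨x * y, hb⟩ : baerHull A) = ⟨x, hx⟩ * ⟨y, hy⟩ from rfl]
    linear_combination e' * (⟨y, hy⟩ : baerHull A) * h + e * algebraMap A (baerHull A) a * h'

namespace Sper

section

variable {R : Type*} [CommRing R] {T : Set R}

theorem mem_supp {α : Sper T} {x : R} : x ∈ α.supp.asIdeal ↔ x ∈ α.cone ∧ -x ∈ α.cone :=
  Iff.rfl

theorem mem_cone_congr {α : Sper T} {x y : R} (h : x - y ∈ α.supp.asIdeal) :
    x ∈ α.cone ↔ y ∈ α.cone := by
  obtain ⟨h1, h2⟩ := mem_supp.1 h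
  exact ⟨fun hx => by simpa using add_mem hx h2, fun hy => by simpa using add_mem hy h1⟩

theorem cone_injective : Function.Injective (cone : Sper T → RingPreordering R) :=
  fun _ _ h => Sper.ext h

theorem isOpen_basicOpen (x : R) : IsOpen (basicOpen T x) :=
  TopologicalSpace.isOpen_generateFrom_of_mem ⟨x, rfl⟩

theorem continuous_supp : Continuous (supp : Sper T → PrimeSpectrum R) := by
  refine PrimeSpectrum.isTopologicalBasis_basic_opens.continuous_iff.2 ?_
  rintro _ ⟨x, rfl⟩
  -- The preimage of $D(x)$ is $P(x^2)$, because squares lie in every cone.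
  convert isOpen_basicOpen (T := T) (x ^ 2) using 1
  ext α
  change x ∉ α.supp.asIdeal ↔ x ^ 2 ∈ α.cone ∧ x ^ 2 ∉ α.supp.asIdeal
  rw [α.supp.isPrime.pow_mem_iff_mem 2 two_pos]
  exact ⟨fun h => ⟨α.cone.pow_two_mem x, h⟩, And.right⟩

theorem continuous_comap {S : Type*} [CommRing S] {U : Set S} (f : R →+* S)
    (hf : ∀ t ∈ T, f t ∈ U) : Continuous (comap f hf) := by
  refine continuous_generateFrom_iff.2 ?_
  rintro _ ⟨x, rfl⟩
  convert isOpen_basicOpen (T := U) (f x) using 1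
  ext β
  change f x ∈ β.cone ∧ ¬ (f x ∈ β.cone ∧ f (-x) ∈ β.cone) ↔
    f x ∈ β.cone ∧ ¬ (f x ∈ β.cone ∧ -f x ∈ β.cone)
  rw [map_neg]

end

/-! ### The fibre product and the lifting of prime cones -/

variable {A B : Type*} [CommRing A] [CommRing B] [Algebra A B] {T : Set A}

/-- The image of `β` in the fibre product of `Sper A` and `Spec B` over `Spec A`. -/
def toPullback (β : Sper (extendedCone B T)) :
    Function.Pullback (supp : Sper T → PrimeSpectrum A)
      (PrimeSpectrum.comap (algebraMap A B)) :=
  ⟨(comap (algebraMap A B) (algebraMap_mem_extendedCone B T) β, β.supp), by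
    ext x
    change algebraMap A B x ∈ β.cone ∧ algebraMap A B (-x) ∈ β.cone ↔
      algebraMap A B x ∈ β.cone ∧ -algebraMap A B x ∈ β.cone
    rw [map_neg]⟩

theorem continuous_toPullback : Continuous (toPullback (B := B) (T := T)) :=
  ((continuous_comap _ _).prodMk continuous_supp).subtype_mk _

variable (hB : IsLocallyConstantAlgebra A B)
  (z : Function.Pullback (supp : Sper T → PrimeSpectrum A)
    (PrimeSpectrum.comap (algebraMap A B)))

theorem exists_sub_algebraMap_mem (hB : IsLocallyConstantAlgebra A B) (p : PrimeSpectrum B) (b : B) :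
    ∃ a : A, b - algebraMap A B a ∈ p.asIdeal := by
  obtain ⟨e, a, he, h⟩ := hB p b
  exact ⟨a, (p.isPrime.mem_or_mem (h ▸ p.asIdeal.zero_mem)).resolve_left he⟩

theorem algebraMap_mem_snd_iff {a : A} :
    algebraMap A B a ∈ z.snd.asIdeal ↔ a ∈ z.fst.supp.asIdeal := by
  have h : z.fst.supp = PrimeSpectrum.comap (algebraMap A B) z.snd := z.2
  rw [h]; rfl

/-- The preimage in `B` of the cone `α / supp α` under `B → B / p = A / supp α`. -/
def liftedCone : Set B :=
  {b | ∃ a ∈ z.fst.cone, b - algebraMap A B a ∈ z.snd.asIdeal}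

-- Two representatives of $b$ differ by an element of $\mathfrak p \cap A = \operatorname{supp}
-- \alpha$, and a cone is a union of cosets of its support; so any representative decides
-- membership.
variable {z} in
theorem mem_liftedCone_iff {a : A} {b : B} (h : b - algebraMap A B a ∈ z.snd.asIdeal) :
    b ∈ liftedCone z ↔ a ∈ z.fst.cone := by
  refine ⟨?_, fun ha => ⟨a, ha, h⟩⟩
  rintro ⟨a', ha', h'⟩
  refine (mem_cone_congr ((algebraMap_mem_snd_iff z).1 ?_)).2 ha'
  have := z.snd.asIdeal.sub_mem h' h
  rw [map_sub]
  convert this using 1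
  ring

theorem algebraMap_mem_liftedCone_iff {a : A} :
    algebraMap A B a ∈ liftedCone z ↔ a ∈ z.fst.cone :=
  mem_liftedCone_iff (by simp)

/-- The prime cone of `B` with given support and given restriction to `A`. -/
def ofPullback : Sper (extendedCone B T) where
  cone := RingPreordering.mk' (liftedCone z)
    (by
      rintro x y ⟨a, ha, h⟩ ⟨a', ha', h'⟩
      refine ⟨a + a', add_mem ha ha', ?_⟩
      convert z.snd.asIdeal.add_mem h h' using 1
      rw [map_add]; ring)
    (by
      rintro x y ⟨a, ha, h⟩ ⟨a', ha', h'⟩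
      refine ⟨a * a', mul_mem ha ha', ?_⟩
      -- $xy - aa' = (x - a)y + a(y - a')$.
      convert z.snd.asIdeal.add_mem (z.snd.asIdeal.mul_mem_right y h)
        (z.snd.asIdeal.mul_mem_left (algebraMap A B a) h') using 1
      rw [map_mul]; ring)
    (by
      intro x
      obtain ⟨a, h⟩ := exists_sub_algebraMap_mem hB z.snd x
      refine ⟨a * a, z.fst.cone.mul_self_mem a, ?_⟩
      convert z.snd.asIdeal.mul_mem_right (x + algebraMap A B a) h using 1
      rw [map_mul]; ring)
    (by
      have := (algebraMap_mem_liftedCone_iff z (a := -1)).not.2 z.fst.cone.neg_one_notMem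
      rwa [map_neg, map_one] at this)
  isOrdering := by
    refine RingPreordering.isOrdering_iff.2 fun x y hxy => ?_
    obtain ⟨a, h⟩ := exists_sub_algebraMap_mem hB z.snd x
    obtain ⟨a', h'⟩ := exists_sub_algebraMap_mem hB z.snd y
    have hxy' : -(x * y) ∈ liftedCone z := hxy
    rw [mem_liftedCone_iff (a := -(a * a')) (by
      convert z.snd.asIdeal.neg_mem (z.snd.asIdeal.add_mem (z.snd.asIdeal.mul_mem_right y h)
        (z.snd.asIdeal.mul_mem_left (algebraMap A B a) h')) using 1
      rw [map_neg, map_mul]; ring)] at hxy'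
    exact (RingPreordering.isOrdering_iff.1 z.fst.isOrdering a a' hxy').imp
      (mem_liftedCone_iff h).2 (mem_liftedCone_iff h').2
  subset := by
    rintro _ ⟨n, b, a, ha, rfl⟩
    refine sum_mem fun i _ => mul_mem (RingPreordering.pow_two_mem _ _) ?_
    exact (algebraMap_mem_liftedCone_iff z).2 (z.fst.subset (ha i))

theorem mem_cone_ofPullback {b : B} : b ∈ (ofPullback hB z).cone ↔ b ∈ liftedCone z := Iff.rfl

theorem supp_ofPullback : (ofPullback hB z).supp = z.snd := by
  ext b
  obtain ⟨a, h⟩ := exists_sub_algebraMap_mem hB z.snd b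
  have hneg : -b - algebraMap A B (-a) ∈ z.snd.asIdeal := by
    convert z.snd.asIdeal.neg_mem h using 1
    rw [map_neg]; ring
  rw [mem_supp, mem_cone_ofPullback, mem_cone_ofPullback, mem_liftedCone_iff h,
    mem_liftedCone_iff hneg, ← mem_supp, ← algebraMap_mem_snd_iff]
  exact ⟨fun ha => by simpa using z.snd.asIdeal.add_mem h ha,
    fun hb => by simpa using z.snd.asIdeal.sub_mem hb h⟩

theorem toPullback_ofPullback : toPullback (ofPullback hB z) = z := by
  refine Subtype.ext (Prod.ext (cone_injective (SetLike.ext fun a => ?_)) (supp_ofPullback hB z))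
  exact algebraMap_mem_liftedCone_iff z

theorem ofPullback_toPullback (β : Sper (extendedCone B T)) :
    ofPullback hB (toPullback β) = β := by
  refine cone_injective (SetLike.ext fun b => ?_)
  obtain ⟨a, h⟩ := exists_sub_algebraMap_mem hB β.supp b
  rw [mem_cone_ofPullback, mem_liftedCone_iff (z := toPullback β) h, mem_cone_congr h]
  rfl

/-- Over $D(e)$, where $b$ and $a$ agree, the preimage of $P(b)$ is the set of points whose first
component lies in $P(a)$; intersecting with $D(e)$ gives an open neighbourhood of $z$ inside the
preimage. -/
theorem continuous_ofPullback : Continuous (ofPullback (T := T) hB) := by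
  refine continuous_generateFrom_iff.2 ?_
  rintro _ ⟨b, rfl⟩
  refine isOpen_iff_forall_mem_open.2 fun z hz => ?_
  obtain ⟨e, a, he, hea⟩ := hB z.snd b
  have key : ∀ w : Function.Pullback (supp : Sper T → PrimeSpectrum A)
      (PrimeSpectrum.comap (algebraMap A B)), e ∉ w.snd.asIdeal →
      (ofPullback hB w ∈ basicOpen (extendedCone B T) b ↔ w.fst ∈ basicOpen T a) := by
    intro w hw
    have h : b - algebraMap A B a ∈ w.snd.asIdeal :=
      (w.snd.isPrime.mem_or_mem (hea ▸ w.snd.asIdeal.zero_mem)).resolve_left hw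
    refine and_congr (mem_liftedCone_iff h) (not_congr ?_)
    rw [supp_ofPullback, ← algebraMap_mem_snd_iff]
    exact ⟨fun hb => by simpa using w.snd.asIdeal.sub_mem hb h,
      fun ha => by simpa using w.snd.asIdeal.add_mem h ha⟩
  refine ⟨{w | w.snd ∈ PrimeSpectrum.basicOpen e ∧ w.fst ∈ basicOpen T a},
    fun w hw => (key w hw.1).2 hw.2, ?_, he, (key z he).1 hz⟩
  exact ((PrimeSpectrum.basicOpen e).isOpen.preimage
      (continuous_snd.comp continuous_subtype_val)).inter
    ((isOpen_basicOpen a).preimage (continuous_fst.comp continuous_subtype_val))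

/-- For a locally constant `A`-algebra `B`, the real spectrum of `B` is the fibre product of
`Sper A` and `Spec B` over `Spec A`. -/
def homeomorphPullback : Sper (extendedCone B T) ≃ₜ
    Function.Pullback (supp : Sper T → PrimeSpectrum A)
      (PrimeSpectrum.comap (algebraMap A B)) where
  toFun := toPullback
  invFun := ofPullback hB
  left_inv := ofPullback_toPullback hB
  right_inv := toPullback_ofPullback hB
  continuous_toFun := continuous_toPullback
  continuous_invFun := continuous_ofPullback hB

end Sper

theorem mainTheorem4 {A : Type*} [CommRing A] [PartialOrder A] [IsOrderedRing A]
    [IsFormallyReal A] (hA : IsVonNeumannRegular A) :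
    ∃ ψ : Sper (extendedCone (baerHull A) (positiveCone A)) ≃ₜ
        Function.Pullback (Sper.supp : Sper (positiveCone A) → PrimeSpectrum A)
          (PrimeSpectrum.comap (algebraMap A (baerHull A))),
      ∀ β : Sper (extendedCone (baerHull A) (positiveCone A)),
        (ψ β).fst = Sper.comap (algebraMap A (baerHull A))
          (algebraMap_mem_extendedCone (baerHull A) (positiveCone A)) β ∧
        (ψ β).snd = β.supp := by
  have := hA.isReduced
  exact ⟨Sper.homeomorphPullback (isLocallyConstantAlgebra_baerHull A), fun β => ⟨rfl, rfl⟩⟩
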